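/- Let $\mathcal H_1$ be a separable real Hilbert space and let $\mathcal H_2$ be an infinite-dimensional separable real Hilbert space with a fixed orthonormal basis $\rho_1,\rho_2,\dots$ (for instance $\mathcal H_1=\mathcal H_2=L^2[0,1]$). For $p\ge 1$ let $\mathcal S^p=\{\gamma\in\mathbb R^p:\|\gamma\|=1\}$ be the unit sphere of the Euclidean space $\mathbb R^p$, and identify $\gamma=(\gamma_1,\dots,\gamma_p)\in\mathcal S^p$ with $\sum_{j=1}^p\gamma_j\rho_j\in\mathcal H_2$. Let $U$ and $X$ be random variables on a probability space $(\Omega,\mathcal F,\mathbb P)$ with values in $\mathcal H_1$ and $\mathcal H_2$, respectively, such that $\mathbb E\|U\|<\infty$ and $\mathbb E(U)=0$. For $\gamma\in\mathcal S^p$ let $F_\gamma(t)=\mathbb P(\langle X,\gamma\rangle\le t)$, $t\in\mathbb R$. **(A)** The following statements are equivalent: 1. $\mathbb E(U\mid X)=0$ almost surely; 2. for all $p\ge1$ and all $\gamma\in\mathcal S^p$, the expectation $\mathbb E\big[\langle U,\mathbb E(U\mid\langle X,\gamma\rangle)\rangle\big]$ exists (that is, the random variable $\langle U,\mathbb E(U\mid\langle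 X,\gamma\rangle)\rangle$ is integrable) and is equal to $0$; 3. for all $p\ge1$ and all $\gamma\in\mathcal S^p$, the expectation $\mathbb E\big[\langle U,\mathbb E\{U\mid F_\gamma(\langle X,\gamma\rangle)\}\rangle\big]$ exists (in the same sense) and is equal to $0$. **(B)** Suppose in addition that $\mathbb E\big(\|U\|\exp\{s\|X\|\}\big)<\infty$ for every real $s>0$. If $\mathbb P[\mathbb E(U\mid X)=0]<1$, then there is an integer $p_0\ge1$ such that for every integer $p\ge p_0$ the two sets $$\{\gamma\in\mathcal S^p:\ \mathbb E(U\mid\langle X,\gamma\rangle)=0\ \text{a.s.}\}\quad\text{and}\quad\{\gamma\in\mathcal S^p:\ \mathbb E(U\mid F_\gamma(\langle X,\gamma\rangle))=0\ \text{a.s.}\}$$ coincide, and this set has Lebesgue (surface) measure zero on $\mathcal S^p$ and is not dense in $\mathcal S^p$. -/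

import Mathlib

open MeasureTheory ProbabilityTheory

noncomputable section

namespace DimRed

/-- The unit hypersphere of the Euclidean space of dimension `p`. -/
abbrev Sph (p : ℕ) : Type := Metric.sphere (0 : EuclideanSpace ℝ (Fin p)) 1

/-- The conditional expectation `E(U | Y)` given the random variable `Y`, that is, given the
σ-algebra generated by `Y`. -/
def condExpGiven {Ω S H : Type*} [MeasurableSpace Ω] [mS : MeasurableSpace S]
    [NormedAddCommGroup H] [NormedSpace ℝ H] [CompleteSpace H]
    (P : Measure Ω) (U : Ω → H) (Y : Ω → S) : Ω → H :=
  P[U | MeasurableSpace.comap Y mS]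

section projections

variable {Ω H : Type*} [NormedAddCommGroup H] [InnerProductSpace ℝ H]

/-- The vector `γ = (γ₁, …, γ_p)` seen as the element `∑_{j ≤ p} γ_j ρ_j` of the Hilbert space with
orthonormal basis `ρ` (indexed from `0`). -/
def embed (ρ : HilbertBasis ℕ ℝ H) {p : ℕ} (γ : Sph p) : H :=
  ∑ j : Fin p, (γ : EuclideanSpace ℝ (Fin p)) j • ρ (j : ℕ)

/-- The real random variable `⟨X, γ⟩`. -/
def proj (ρ : HilbertBasis ℕ ℝ H) (X : Ω → H) {p : ℕ} (γ : Sph p) : Ω → ℝ :=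
  fun ω => inner ℝ (X ω) (embed ρ γ)

/-- The random variable `F_γ(⟨X, γ⟩)`, where `F_γ(t) = P(⟨X, γ⟩ ≤ t)`. -/
def cdfProj [MeasurableSpace Ω] (P : Measure Ω) (ρ : HilbertBasis ℕ ℝ H) (X : Ω → H) {p : ℕ}
    (γ : Sph p) : Ω → ℝ :=
  fun ω => P.real {ω' | proj ρ X γ ω' ≤ proj ρ X γ ω}

end projections

/-- `E⟨U, E(U | Y)⟩ = 0`: the expectation exists and vanishes. -/
def InnerCondExpZero {Ω S H : Type*} [MeasurableSpace Ω] [MeasurableSpace S]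
    [NormedAddCommGroup H] [InnerProductSpace ℝ H] [CompleteSpace H]
    (P : Measure Ω) (U : Ω → H) (Y : Ω → S) : Prop :=
  Integrable (fun ω => inner ℝ (U ω) (condExpGiven P U Y ω)) P ∧
    ∫ ω, inner ℝ (U ω) (condExpGiven P U Y ω) ∂P = 0

end DimRed

end

open Filter Topology Set

/-! For real integrable `f`, E(f | Y) = 0 says that the image under `Y` of the signed measure `f ·
P` vanishes, which can be tested on half-lines or by Fourier transform. A Hilbert-valued `U` reduces
to the scalars ⟨x, U⟩.

(A) The transform at rγ involves only ⟨X, γ⟩, and the vectors rγ are dense, so the projections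
detect E(U | X). Moreover E⟨U, E(U | Y)⟩ = E‖E(U | Y)‖², and passing from Y to F(Y) loses only null
sets.

(B) Exponential moments let the transform be expanded in powers: E(U | ⟨X, γ⟩) = 0 iff every E⟨x,
U⟩⟨X, γ⟩ᵏ vanishes. These are continuous homogeneous polynomials in γ. One that is nonzero at some
γ₀ in dimension p₀ stays nonzero at γ₀ padded with zeros, so for p ≥ p₀ the exceptional set is
closed, proper and null. -/

namespace DimRed

/-! ### Vanishing conditional expectations and signed laws -/

section CondExp

variable {Ω H S : Type*} {m m0 : MeasurableSpace Ω} [MeasurableSpace S] {P : Measure Ω}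

/-- The distribution of `Y` under the positive part of the signed measure of density `f`. -/
noncomputable def posLaw (P : Measure Ω) (f : Ω → ℝ) (Y : Ω → S) : Measure S :=
  (P.withDensity fun ω => ENNReal.ofReal (f ω)).map Y

theorem isFiniteMeasure_posLaw {f : Ω → ℝ} (hf : Integrable f P) (Y : Ω → S) :
    IsFiniteMeasure (posLaw P f Y) := by
  have := isFiniteMeasure_withDensity_ofReal hf.2
  unfold posLaw
  infer_instance

theorem integral_posLaw [NormedAddCommGroup H] [NormedSpace ℝ H] {f : Ω → ℝ} (hf : Integrable f P)
    {Y : Ω → S} (hY : Measurable Y) {g : S → H} (hg : StronglyMeasurable g) :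
    ∫ y, g y ∂(posLaw P f Y) = ∫ ω, max (f ω) 0 • g (Y ω) ∂P := by
  unfold posLaw
  rw [integral_map hY.aemeasurable hg.aestronglyMeasurable,
    integral_withDensity_eq_integral_toReal_smul₀ hf.aemeasurable.ennreal_ofReal (by simp)]
  simp [ENNReal.toReal_ofReal']

theorem integral_posLaw_sub [NormedAddCommGroup H] [NormedSpace ℝ H] {f : Ω → ℝ}
    (hf : Integrable f P) {Y : Ω → S} (hY : Measurable Y) {g : S → H} (hg : StronglyMeasurable g)
    {C : ℝ} (hC : ∀ y, ‖g y‖ ≤ C) :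
    ∫ y, g y ∂(posLaw P f Y) - ∫ y, g y ∂(posLaw P (fun ω => -f ω) Y)
      = ∫ ω, f ω • g (Y ω) ∂P := by
  have hgY : AEStronglyMeasurable (fun ω => g (Y ω)) P :=
    (hg.comp_measurable hY).aestronglyMeasurable
  have hneg : Integrable (fun ω => -f ω) P := hf.neg
  have hb : ∀ᵐ ω ∂P, ‖g (Y ω)‖ ≤ C := ae_of_all _ fun ω => hC _
  rw [integral_posLaw hf hY hg, integral_posLaw hneg hY hg, ← integral_sub]
  · refine integral_congr_ae (ae_of_all _ fun ω => ?_)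
    simp only [← sub_smul]
    congr 1
    rcases le_total (f ω) 0 with h | h
    · rw [max_eq_right h, max_eq_left (by linarith)]; ring
    · rw [max_eq_left h, max_eq_right (by linarith)]; ring
  · exact hf.pos_part.smul_bdd C hgY hb
  · exact hneg.pos_part.smul_bdd C hgY hb

variable [IsProbabilityMeasure P]

theorem condExp_eq_zero_iff [NormedAddCommGroup H] [NormedSpace ℝ H] [CompleteSpace H]
    (hm : m ≤ m0) {U : Ω → H} (hU : Integrable U P) :
    (∀ᵐ ω ∂P, P[U | m] ω = 0) ↔ ∀ s, MeasurableSet[m] s → ∫ ω in s, U ω ∂P = 0 := by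
  constructor
  · intro h s hs
    rw [← setIntegral_condExp hm hU hs, setIntegral_congr_ae (g := fun _ => (0 : H)) (hm s hs)
      (h.mono fun ω hω _ => hω)]
    simp
  · intro h
    have := ae_eq_condExp_of_forall_setIntegral_eq hm (g := fun _ => (0 : H)) hU
      (fun s _ _ => by simp) (fun s hs _ => by simp [h s hs])
      aestronglyMeasurable_const
    exact this.symm

theorem condExp_eq_zero_of_le [NormedAddCommGroup H] [NormedSpace ℝ H] [CompleteSpace H]
    {m₁ : MeasurableSpace Ω} (hm : m ≤ m0) (hle : m₁ ≤ m) {U : Ω → H} (hU : Integrable U P)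
    (h : ∀ᵐ ω ∂P, P[U | m] ω = 0) : ∀ᵐ ω ∂P, P[U | m₁] ω = 0 := by
  rw [condExp_eq_zero_iff hm hU] at h
  rw [condExp_eq_zero_iff (hle.trans hm) hU]
  exact fun s hs => h s (hle s hs)

theorem condExp_eq_zero_iff_inner [NormedAddCommGroup H] [InnerProductSpace ℝ H] [CompleteSpace H]
    (hm : m ≤ m0) {U : Ω → H} (hU : Integrable U P) :
    (∀ᵐ ω ∂P, P[U | m] ω = 0) ↔ ∀ h : H, ∀ᵐ ω ∂P, P[fun ω => inner ℝ h (U ω) | m] ω = 0 := by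
  have hUh : ∀ h : H, Integrable (fun ω => inner ℝ h (U ω)) P := fun h => hU.const_inner h
  simp_rw [condExp_eq_zero_iff hm hU, fun h => condExp_eq_zero_iff hm (hUh h)]
  have key : ∀ (h : H) s, ∫ ω in s, inner ℝ h (U ω) ∂P = inner ℝ h (∫ ω in s, U ω ∂P) :=
    fun h s => integral_inner hU.integrableOn h
  simp_rw [key]
  constructor
  · intro h x s hs
    rw [h s hs, inner_zero_right]
  · intro h s hs
    exact inner_self_eq_zero.1 (h _ s hs)

theorem integral_smul_eq_zero_of_condExp_eq_zero [NormedAddCommGroup H] [NormedSpace ℝ H]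
    [CompleteSpace H] (hm : m ≤ m0) {f : Ω → ℝ} (hf : Integrable f P)
    (h : ∀ᵐ ω ∂P, P[f | m] ω = 0) {g : Ω → H} (hg : StronglyMeasurable[m] g)
    (hfg : Integrable (fun ω => f ω • g ω) P) : ∫ ω, f ω • g ω ∂P = 0 := by
  have := condExp_bilin_of_stronglyMeasurable_right (ContinuousLinearMap.lsmul ℝ ℝ) hg
    (f := f) (μ := P) (by simpa using hfg) hf
  simp only [ContinuousLinearMap.lsmul_apply] at this
  rw [← integral_condExp hm, integral_congr_ae this, integral_congr_ae (g := fun _ => (0 : H))]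
  · simp
  · filter_upwards [h] with ω hω
    simp [hω]

theorem condExp_eq_zero_of_posLaw_eq {f : Ω → ℝ} (hf : Integrable f P)
    {Y : Ω → S} (hY : Measurable Y) (h : posLaw P f Y = posLaw P (fun ω => -f ω) Y) :
    ∀ᵐ ω ∂P, condExpGiven P f Y ω = 0 := by
  unfold condExpGiven
  rw [condExp_eq_zero_iff hY.comap_le hf]
  rintro _ ⟨B, hB, rfl⟩
  have := integral_posLaw_sub hf hY (g := B.indicator fun _ => (1 : ℝ))
    (stronglyMeasurable_const.indicator hB) (C := 1) (fun y => by
      by_cases hy : y ∈ B <;> simp [hy])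
  rw [h, sub_self] at this
  rw [← integral_indicator (hY hB), this]
  refine integral_congr_ae (ae_of_all _ fun ω => ?_)
  by_cases hy : Y ω ∈ B <;> simp [hy]

/-- Characteristic functions of finite measures are continuous, so agreement on a dense set
identifies the two laws. -/
theorem condExp_eq_zero_of_integral_char_eq_zero [NormedAddCommGroup S] [InnerProductSpace ℝ S]
    [CompleteSpace S] [BorelSpace S] [SecondCountableTopology S] {f : Ω → ℝ} (hf : Integrable f P)
    {Y : Ω → S} (hY : Measurable Y) {D : Set S} (hD : Dense D)
    (h : ∀ t ∈ D, ∫ ω, f ω • Complex.exp (inner ℝ (Y ω) t * Complex.I) ∂P = 0) :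
    ∀ᵐ ω ∂P, condExpGiven P f Y ω = 0 := by
  apply condExp_eq_zero_of_posLaw_eq hf hY
  have := isFiniteMeasure_posLaw hf Y
  have := isFiniteMeasure_posLaw hf.neg Y
  change IsFiniteMeasure (posLaw P (fun ω => -f ω) Y) at this
  refine Measure.ext_of_charFun (Continuous.ext_on hD continuous_charFun continuous_charFun ?_)
  intro t ht
  rw [← sub_eq_zero, charFun_apply, charFun_apply, integral_posLaw_sub hf hY (C := 1), h t ht]
  · exact Continuous.stronglyMeasurable (by fun_prop)
  · intro y
    rw [Complex.norm_exp_ofReal_mul_I]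

theorem condExp_eq_zero_of_setIntegral_le_eq_zero {f : Ω → ℝ} (hf : Integrable f P)
    {Y : Ω → ℝ} (hY : Measurable Y) (h : ∀ t, ∫ ω in {ω | Y ω ≤ t}, f ω ∂P = 0) :
    ∀ᵐ ω ∂P, condExpGiven P f Y ω = 0 := by
  apply condExp_eq_zero_of_posLaw_eq hf hY
  have := isFiniteMeasure_posLaw hf Y
  have := isFiniteMeasure_posLaw hf.neg Y
  change IsFiniteMeasure (posLaw P (fun ω => -f ω) Y) at this
  refine Measure.ext_of_Iic _ _ fun t => ?_
  rw [← measureReal_eq_measureReal_iff, ← sub_eq_zero]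
  have := integral_posLaw_sub hf hY (g := (Iic t).indicator fun _ => (1 : ℝ))
    (stronglyMeasurable_const.indicator measurableSet_Iic) (C := 1) (fun y => by
      by_cases hy : y ∈ Iic t <;> simp only [hy, indicator_of_mem, indicator_of_notMem,
        not_false_eq_true] <;> simp)
  rw [integral_indicator measurableSet_Iic, integral_indicator measurableSet_Iic] at this
  simp only [setIntegral_const, smul_eq_mul, mul_one] at this
  rw [this, ← h t, ← integral_indicator (measurableSet_le hY measurable_const)]
  refine integral_congr_ae (ae_of_all _ fun ω => ?_)
  by_cases hy : Y ω ≤ t <;> simp [hy]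

/-- A finite measure on the line does not charge the set of points to the right of `t` where its
distribution function takes the same value as at `t`. -/
theorem measure_flat_eq_zero (μ : Measure ℝ) [IsFiniteMeasure μ] (t : ℝ) :
    μ {s | t < s ∧ μ.real (Iic s) = μ.real (Iic t)} = 0 := by
  set T := {s | t < s ∧ μ.real (Iic s) = μ.real (Iic t)} with hT
  have hnull : ∀ s ∈ T, μ (Ioc t s) = 0 := by
    rintro s ⟨hs, hs'⟩
    rw [measureReal_eq_measureReal_iff] at hs'
    rw [← Iic_sdiff_Iic, measure_sdiff (Iic_subset_Iic.2 hs.le) measurableSet_Iic.nullMeasurableSet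
      (measure_ne_top _ _), hs', tsub_self]
  refine measure_null_of_locally_null T fun x hx => ?_
  -- If `x` is the largest point of `T`, then `T` lies in the null interval (t, x]; otherwise a
  -- larger `y` in `T` makes (t, y] a null neighbourhood of `x`.
  by_cases hmax : ∀ y ∈ T, y ≤ x
  · refine ⟨T, self_mem_nhdsWithin, measure_mono_null (fun y hy => ?_) (hnull x hx)⟩
    exact ⟨hy.1, hmax y hy⟩
  · push Not at hmax
    obtain ⟨y, hy, hxy⟩ := hmax
    exact ⟨Ioc t y, mem_nhdsWithin_of_mem_nhds (Ioc_mem_nhds hx.1 hxy), hnull y hy⟩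

theorem condExpGiven_cdf_eq_zero_iff [NormedAddCommGroup H] [InnerProductSpace ℝ H]
    [CompleteSpace H] {U : Ω → H} (hU : Integrable U P) {Y : Ω → ℝ} (hY : Measurable Y) :
    (∀ᵐ ω ∂P, condExpGiven P U (fun ω => P.real {ω' | Y ω' ≤ Y ω}) ω = 0) ↔
      ∀ᵐ ω ∂P, condExpGiven P U Y ω = 0 := by
  set μ := P.map Y with hμ
  have : IsProbabilityMeasure μ := Measure.isProbabilityMeasure_map hY.aemeasurable
  have hF : (fun ω => P.real {ω' | Y ω' ≤ Y ω}) = fun ω => μ.real (Iic (Y ω)) := by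
    ext ω
    rw [hμ, map_measureReal_apply hY measurableSet_Iic]
    rfl
  have hmono : Monotone fun t => μ.real (Iic t) := fun a b hab =>
    measureReal_mono (Iic_subset_Iic.2 hab)
  have hFY : Measurable fun ω => μ.real (Iic (Y ω)) := hmono.measurable.comp hY
  rw [hF]
  unfold condExpGiven
  constructor
  · rw [condExp_eq_zero_iff_inner hY.comap_le hU, condExp_eq_zero_iff_inner hFY.comap_le hU]
    intro h x
    have hUx : Integrable (fun ω => inner ℝ x (U ω)) P := hU.const_inner x
    refine condExp_eq_zero_of_setIntegral_le_eq_zero hUx hY fun t => ?_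
    have h0 := (condExp_eq_zero_iff hFY.comap_le hUx).1 (h x) _
      ⟨Iic (μ.real (Iic t)), measurableSet_Iic, rfl⟩
    rw [← h0]
    refine setIntegral_congr_set ?_
    -- The events Y ≤ t and F(Y) ≤ F(t) differ only where Y > t and F(Y) = F(t), a flat stretch of
    -- F.
    have hn : P (Y ⁻¹' {s | t < s ∧ μ.real (Iic s) = μ.real (Iic t)}) = 0 :=
      nonpos_iff_eq_zero.1 ((Measure.le_map_apply hY.aemeasurable _).trans
        (measure_flat_eq_zero μ t).le)
    filter_upwards [compl_mem_ae_iff.2 hn] with ω hω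
    refine propext ⟨fun hle => hmono hle, fun hle => ?_⟩
    by_contra hlt
    have hlt : t < Y ω := not_le.1 hlt
    exact hω ⟨hlt, le_antisymm hle (hmono hlt.le)⟩
  · refine condExp_eq_zero_of_le hY.comap_le ?_ hU
    rintro _ ⟨B, hB, rfl⟩
    exact ⟨(fun t => μ.real (Iic t)) ⁻¹' B, hmono.measurable hB, rfl⟩

/-- Conditioning ⟨U, E(U | Y)⟩ on Y gives ‖E(U | Y)‖². The assumed integrability of the product is
what permits pulling out the factor, as U need not be square integrable. -/
theorem innerCondExpZero_iff [NormedAddCommGroup H] [InnerProductSpace ℝ H]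
    [CompleteSpace H] {U : Ω → H} (hU : Integrable U P) {Y : Ω → S} (hY : Measurable Y) :
    InnerCondExpZero P U Y ↔ ∀ᵐ ω ∂P, condExpGiven P U Y ω = 0 := by
  constructor
  · rintro ⟨hint, h0⟩
    have hpull := condExp_bilin_of_stronglyMeasurable_right (innerSL ℝ)
      (stronglyMeasurable_condExp (μ := P) (m := MeasurableSpace.comap Y inferInstance) (f := U))
      (f := U) (μ := P) hint hU
    have hsq : Integrable (fun ω => ‖condExpGiven P U Y ω‖ ^ 2) P := by
      refine (integrable_condExp.congr hpull).congr (ae_of_all _ fun ω => ?_)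
      exact real_inner_self_eq_norm_sq _
    have hz : ∫ ω, ‖condExpGiven P U Y ω‖ ^ 2 ∂P = 0 := by
      rw [← h0]
      refine Eq.trans ?_ (integral_condExp hY.comap_le)
      refine (integral_congr_ae (hpull.trans (ae_of_all _ fun ω => ?_))).symm
      exact real_inner_self_eq_norm_sq _
    rw [integral_eq_zero_iff_of_nonneg (fun ω => by positivity) hsq] at hz
    filter_upwards [hz] with ω hω
    simpa using hω
  · intro h
    have h' : (fun ω => inner ℝ (U ω) (condExpGiven P U Y ω)) =ᵐ[P] fun _ => (0 : ℝ) := by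
      filter_upwards [h] with ω hω
      rw [hω, inner_zero_right]
    refine ⟨(integrable_zero _ _ _).congr h'.symm, ?_⟩
    rw [integral_congr_ae h']
    simp

end CondExp

end DimRed
namespace DimRed

/-! ### Finite-dimensional spheres inside the Hilbert space -/

section Embedding

variable {H : Type*} [NormedAddCommGroup H] [InnerProductSpace ℝ H]

/-- The linear map `v ↦ ∑_{j < p} v_j ρ_j`. -/
noncomputable def embedLin (ρ : HilbertBasis ℕ ℝ H) (p : ℕ) : EuclideanSpace ℝ (Fin p) →ₗ[ℝ] H where
  toFun v := ∑ j : Fin p, v j • ρ (j : ℕ)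
  map_add' v w := by simp [add_smul, Finset.sum_add_distrib]
  map_smul' c v := by simp [mul_smul, Finset.smul_sum]

theorem embed_eq_embedLin (ρ : HilbertBasis ℕ ℝ H) {p : ℕ} (γ : Sph p) :
    embed ρ γ = embedLin ρ p γ := rfl

theorem exists_smul_embed_eq (ρ : HilbertBasis ℕ ℝ H) {p : ℕ} (hp : 1 ≤ p)
    (v : EuclideanSpace ℝ (Fin p)) : ∃ (r : ℝ) (γ : Sph p), embedLin ρ p v = r • embed ρ γ := by
  by_cases hv : v = 0
  · refine ⟨0, ⟨EuclideanSpace.single ⟨0, hp⟩ 1, by simp⟩, by simp [hv]⟩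
  · have hn : ‖v‖ ≠ 0 := norm_ne_zero_iff.2 hv
    refine ⟨‖v‖, ⟨‖v‖⁻¹ • v, by simp [norm_smul, hn]⟩, ?_⟩
    rw [embed_eq_embedLin, ← map_smul, smul_smul, mul_inv_cancel₀ hn, one_smul]

theorem dense_smul_embed (ρ : HilbertBasis ℕ ℝ H) :
    Dense {x : H | ∃ p, 1 ≤ p ∧ ∃ (r : ℝ) (γ : Sph p), x = r • embed ρ γ} := by
  intro x
  refine mem_closure_of_tendsto (ρ.hasSum_repr x).tendsto_sum_nat ?_
  filter_upwards [eventually_ge_atTop 1] with n hn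
  obtain ⟨r, γ, h⟩ := exists_smul_embed_eq ρ hn (WithLp.toLp 2 fun j : Fin n => ρ.repr x j)
  refine ⟨n, hn, r, γ, ?_⟩
  rw [← h, Finset.sum_range]
  rfl

/-- Supplies the separability under which characteristic functions determine Borel measures. -/
theorem secondCountableTopology_of_hilbertBasis (ρ : HilbertBasis ℕ ℝ H) :
    SecondCountableTopology H := by
  have h := (countable_range ρ).isSeparable.span (R := ℝ) |>.closure
  rw [← Submodule.topologicalClosure_coe, ρ.dense_span, Submodule.top_coe,
    TopologicalSpace.isSeparable_univ_iff] at h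
  exact UniformSpace.secondCountable_of_separable H

theorem norm_embed (ρ : HilbertBasis ℕ ℝ H) {p : ℕ} (γ : Sph p) : ‖embed ρ γ‖ = 1 := by
  have ho : Orthonormal ℝ fun j : Fin p => ρ (j : ℕ) := ρ.orthonormal.comp _ Fin.val_injective
  have h1 : ‖(γ : EuclideanSpace ℝ (Fin p))‖ ^ 2 = 1 := by simp
  have h2 : ‖embed ρ γ‖ ^ 2 = 1 := by
    rw [← real_inner_self_eq_norm_sq, embed, ho.inner_sum]
    refine Eq.trans ?_ h1
    rw [EuclideanSpace.real_norm_sq_eq]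
    simp [sq]
  exact (pow_eq_one_iff_of_nonneg (norm_nonneg _) two_ne_zero).1 h2

theorem exists_sph_embed_eq (ρ : HilbertBasis ℕ ℝ H) {p q : ℕ} (hpq : p ≤ q) (γ : Sph p) :
    ∃ γ' : Sph q, embed ρ γ' = embed ρ γ := by
  obtain ⟨r, rfl⟩ := Nat.exists_eq_add_of_le hpq
  let w : EuclideanSpace ℝ (Fin (p + r)) :=
    WithLp.toLp 2 (Fin.append (γ : EuclideanSpace ℝ (Fin p)) fun _ => 0)
  have hw : ‖w‖ = ‖(γ : EuclideanSpace ℝ (Fin p))‖ := by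
    rw [EuclideanSpace.norm_eq, EuclideanSpace.norm_eq, Fin.sum_univ_add]
    simp [w]
  refine ⟨⟨w, by simp [hw]⟩, ?_⟩
  unfold embed
  rw [Fin.sum_univ_add]
  simp [w]

end Embedding

/-! ### Reduction to one-dimensional projections -/

section Projections

variable {Ω H : Type*} [MeasurableSpace Ω] {P : Measure Ω} [IsProbabilityMeasure P]
  [NormedAddCommGroup H] [InnerProductSpace ℝ H] [MeasurableSpace H] [BorelSpace H]
  {X : Ω → H}

theorem measurable_proj (ρ : HilbertBasis ℕ ℝ H) (hX : Measurable X) {p : ℕ} (γ : Sph p) :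
    Measurable (proj ρ X γ) :=
  (continuous_id.inner continuous_const).measurable.comp hX

theorem condExp_eq_zero_of_forall_proj [CompleteSpace H] (ρ : HilbertBasis ℕ ℝ H)
    (hX : Measurable X) {f : Ω → ℝ} (hf : Integrable f P)
    (h : ∀ p, 1 ≤ p → ∀ γ : Sph p, ∀ᵐ ω ∂P, condExpGiven P f (proj ρ X γ) ω = 0) :
    ∀ᵐ ω ∂P, condExpGiven P f X ω = 0 := by
  have := secondCountableTopology_of_hilbertBasis ρ
  refine condExp_eq_zero_of_integral_char_eq_zero hf hX (dense_smul_embed ρ) ?_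
  rintro _ ⟨p, hp, r, γ, rfl⟩
  have hY := measurable_proj ρ hX γ
  have hg : Continuous fun y : ℝ => Complex.exp (((r * y : ℝ) : ℂ) * Complex.I) := by fun_prop
  -- The character at rγ is a function of ⟨X, γ⟩ alone, so it can be pulled out.
  have hm : StronglyMeasurable[MeasurableSpace.comap (proj ρ X γ) inferInstance]
      fun ω => Complex.exp (((r * proj ρ X γ ω : ℝ) : ℂ) * Complex.I) :=
    hg.stronglyMeasurable.comp_measurable (comap_measurable _)
  simp_rw [inner_smul_right]
  refine integral_smul_eq_zero_of_condExp_eq_zero hY.comap_le hf (h p hp γ) hm ?_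
  refine hf.smul_bdd 1 (hm.mono hY.comap_le).aestronglyMeasurable (ae_of_all _ fun ω => ?_)
  rw [Complex.norm_exp_ofReal_mul_I]

theorem condExpGiven_eq_zero_iff_forall_proj {H₁ : Type*} [NormedAddCommGroup H₁]
    [InnerProductSpace ℝ H₁] [CompleteSpace H₁] [CompleteSpace H] (ρ : HilbertBasis ℕ ℝ H)
    (hX : Measurable X) {U : Ω → H₁} (hU : Integrable U P) :
    (∀ᵐ ω ∂P, condExpGiven P U X ω = 0) ↔
      ∀ p, 1 ≤ p → ∀ γ : Sph p, ∀ᵐ ω ∂P, condExpGiven P U (proj ρ X γ) ω = 0 := by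
  constructor
  · intro h p _ γ
    refine condExp_eq_zero_of_le hX.comap_le ?_ hU h
    rintro _ ⟨B, hB, rfl⟩
    exact ⟨(fun x => inner ℝ x (embed ρ γ)) ⁻¹' B,
      (continuous_id.inner continuous_const).measurable hB, rfl⟩
  · intro h
    refine (condExp_eq_zero_iff_inner hX.comap_le hU).2 fun x => ?_
    exact condExp_eq_zero_of_forall_proj ρ hX (hU.const_inner x) fun p hp γ =>
      (condExp_eq_zero_iff_inner (measurable_proj ρ hX γ).comap_le hU).1 (h p hp γ) x

end Projections

/-! ### Moments and their polynomial dependence on the direction -/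

section Moments

variable {Ω : Type*} [MeasurableSpace Ω] {P : Measure Ω}

theorem integrable_mul_pow_of_exp {f Y : Ω → ℝ} (hf : AEStronglyMeasurable f P)
    (hY : AEStronglyMeasurable Y P)
    (hexp : ∀ s : ℝ, 0 < s → Integrable (fun ω => |f ω| * Real.exp (s * |Y ω|)) P) (k : ℕ) :
    Integrable (fun ω => f ω * Y ω ^ k) P := by
  refine Integrable.mono' ((hexp 1 one_pos).const_mul (k.factorial : ℝ)) (hf.mul (hY.pow k))
    (ae_of_all _ fun ω => ?_)
  have h := Real.pow_div_factorial_le_exp |Y ω| (abs_nonneg _) k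
  rw [div_le_iff₀ (by positivity)] at h
  rw [norm_mul, norm_pow, Real.norm_eq_abs, Real.norm_eq_abs, one_mul]
  calc |f ω| * |Y ω| ^ k ≤ |f ω| * (Real.exp |Y ω| * k.factorial) := by gcongr
    _ = _ := by ring

/-- The series of exp(itY) integrates term by term against `f`, with dominating sum |f| exp(|t||Y|);
the moments therefore determine the Fourier transform. -/
theorem condExp_eq_zero_iff_moments [IsProbabilityMeasure P] {f Y : Ω → ℝ} (hf : Integrable f P)
    (hY : Measurable Y)
    (hexp : ∀ s : ℝ, 0 < s → Integrable (fun ω => |f ω| * Real.exp (s * |Y ω|)) P) :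
    (∀ᵐ ω ∂P, condExpGiven P f Y ω = 0) ↔ ∀ k : ℕ, ∫ ω, f ω * Y ω ^ k ∂P = 0 := by
  have hint := integrable_mul_pow_of_exp hf.1 hY.aestronglyMeasurable hexp
  constructor
  · intro h k
    exact integral_smul_eq_zero_of_condExp_eq_zero hY.comap_le hf h
      (g := fun ω => Y ω ^ k) ((comap_measurable Y).pow_const k).stronglyMeasurable (hint k)
  · intro h
    refine condExp_eq_zero_of_integral_char_eq_zero hf hY dense_univ fun t _ => ?_
    have hsum : ∀ ω, HasSum (fun n : ℕ => |f ω| * ((|t| * |Y ω|) ^ n / n.factorial))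
        (|f ω| * Real.exp (|t| * |Y ω|)) := fun ω => by
      rw [Real.exp_eq_exp_ℝ]
      exact (NormedSpace.expSeries_div_hasSum_exp (|t| * |Y ω|)).mul_left _
    have hF : ∀ (n : ℕ) (ω : Ω), f ω • (((inner ℝ (Y ω) t : ℝ) * Complex.I) ^ n / n.factorial)
        = ((f ω * Y ω ^ n : ℝ) : ℂ) * ((t * Complex.I) ^ n / n.factorial) := by
      intro n ω
      simp only [RCLike.inner_apply, conj_trivial, Complex.real_smul]
      push_cast
      ring
    have key := hasSum_integral_of_dominated_convergence (μ := P)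
      (F := fun (n : ℕ) ω => f ω • (((inner ℝ (Y ω) t : ℝ) * Complex.I) ^ n / n.factorial))
      (f := fun ω => f ω • Complex.exp (inner ℝ (Y ω) t * Complex.I))
      (fun n ω => |f ω| * ((|t| * |Y ω|) ^ n / n.factorial)) ?_ ?_ ?_ ?_ ?_
    · refine key.unique ?_
      have h0 : ∀ n : ℕ, ∫ ω, f ω • (((inner ℝ (Y ω) t : ℝ) * Complex.I) ^ n / n.factorial) ∂P
          = 0 := by
        intro n
        simp_rw [hF]
        rw [integral_mul_const, integral_complex_ofReal, h n]
        simp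
      simp_rw [h0]
      exact hasSum_zero
    · intro n
      simp_rw [hF]
      exact ((hint n).ofReal.mul_const _).1
    · refine fun n => ae_of_all _ fun ω => le_of_eq ?_
      simp [mul_comm]
    · exact ae_of_all _ fun ω => (hsum ω).summable
    · simp_rw [fun ω => (hsum ω).tsum_eq]
      -- The added 1 keeps the exponent positive when t = 0.
      refine Integrable.mono' (hexp (|t| + 1) (by positivity)) ?_ (ae_of_all _ fun ω => ?_)
      · exact hf.1.norm.mul (Measurable.aestronglyMeasurable (by fun_prop))
      · rw [Real.norm_of_nonneg (by positivity)]
        gcongr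
        linarith
    · refine ae_of_all _ fun ω => ?_
      rw [Complex.exp_eq_exp_ℂ]
      exact (NormedSpace.expSeries_div_hasSum_exp _).const_smul (f ω)

variable {H : Type*} [NormedAddCommGroup H] [InnerProductSpace ℝ H] [MeasurableSpace H]
  [BorelSpace H] {X : Ω → H} {f : Ω → ℝ} {k : ℕ}

theorem aestronglyMeasurable_inner_const (hX : Measurable X) (v : H) :
    AEStronglyMeasurable (fun ω => inner ℝ (X ω) v) P :=
  ((continuous_id.inner continuous_const).measurable.comp hX).aestronglyMeasurable

theorem continuous_integral_mul_inner_pow (hX : Measurable X) (hf : AEStronglyMeasurable f P)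
    (hk : Integrable (fun ω => f ω * ‖X ω‖ ^ k) P) :
    Continuous fun v : H => ∫ ω, f ω * inner ℝ (X ω) v ^ k ∂P := by
  refine continuous_iff_continuousAt.2 fun v₀ => ?_
  refine continuousAt_of_dominated (bound := fun ω => ‖f ω * ‖X ω‖ ^ k‖ * (‖v₀‖ + 1) ^ k)
    (Eventually.of_forall fun v => hf.mul ((aestronglyMeasurable_inner_const hX v).pow k)) ?_
    (hk.norm.mul_const _) (ae_of_all _ fun ω => ?_)
  · filter_upwards [Metric.ball_mem_nhds v₀ one_pos] with v hv
    refine ae_of_all _ fun ω => ?_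
    have h1 : ‖v‖ ≤ ‖v₀‖ + 1 := by
      have h2 := norm_le_norm_add_norm_sub' v v₀
      rw [mem_ball_iff_norm] at hv
      linarith
    simp only [norm_mul, norm_pow, norm_norm, mul_assoc, ← mul_pow]
    gcongr
    exact (norm_inner_le_norm _ _).trans (by gcongr)
  · exact Continuous.continuousAt (by fun_prop)

theorem exists_polynomial_integral_mul_inner_pow (hX : Measurable X)
    (hf : AEStronglyMeasurable f P) (hk : Integrable (fun ω => f ω * ‖X ω‖ ^ k) P) (v₀ v : H) :
    ∃ q : Polynomial ℝ, ∀ t : ℝ, ∫ ω, f ω * inner ℝ (X ω) (v₀ + t • v) ^ k ∂P = q.eval t := by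
  have hint : ∀ j ∈ Finset.range (k + 1), Integrable
      (fun ω => f ω * (inner ℝ (X ω) v ^ j * inner ℝ (X ω) v₀ ^ (k - j) * k.choose j)) P := by
    intro j hj
    have hjk : j + (k - j) = k := by have := Finset.mem_range.1 hj; omega
    refine Integrable.mono' (hk.norm.mul_const (‖v‖ ^ j * ‖v₀‖ ^ (k - j) * k.choose j))
      (hf.mul ((((aestronglyMeasurable_inner_const hX v).pow j).mul
        ((aestronglyMeasurable_inner_const hX v₀).pow (k - j))).mul_const _))
      (ae_of_all _ fun ω => ?_)
    simp only [norm_mul, norm_pow, norm_norm, RCLike.norm_natCast]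
    calc ‖f ω‖ * (‖inner ℝ (X ω) v‖ ^ j * ‖inner ℝ (X ω) v₀‖ ^ (k - j) * k.choose j)
        ≤ ‖f ω‖ * ((‖X ω‖ * ‖v‖) ^ j * (‖X ω‖ * ‖v₀‖) ^ (k - j) * k.choose j) := by
          gcongr <;> exact norm_inner_le_norm _ _
      _ = ‖f ω‖ * ‖X ω‖ ^ (j + (k - j)) * (‖v‖ ^ j * ‖v₀‖ ^ (k - j) * k.choose j) := by
          rw [mul_pow, mul_pow, pow_add]; ring
      _ = _ := by rw [hjk]
  refine ⟨∑ j ∈ Finset.range (k + 1), Polynomial.monomial j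
    (∫ ω, f ω * (inner ℝ (X ω) v ^ j * inner ℝ (X ω) v₀ ^ (k - j) * k.choose j) ∂P), fun t => ?_⟩
  rw [Polynomial.eval_finsetSum]
  simp_rw [Polynomial.eval_monomial, ← integral_mul_const]
  rw [← integral_finsetSum _ fun j hj => (hint j hj).mul_const _]
  refine integral_congr_ae (ae_of_all _ fun ω => ?_)
  simp only
  rw [inner_add_right, inner_smul_right, add_comm, add_pow, Finset.mul_sum]
  refine Finset.sum_congr rfl fun j _ => ?_
  rw [mul_pow]
  ring

end Moments

/-! ### Null zero sets -/

section NullSet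

variable {E : Type*} [NormedAddCommGroup E] [NormedSpace ℝ E] [MeasurableSpace E] [BorelSpace E]
  [FiniteDimensional ℝ E] (μ : Measure E) [μ.IsAddHaarMeasure]

/-- The zero set of a continuous function that is polynomial along the lines through a point where
it does not vanish is negligible. -/
theorem measure_zeros_eq_zero {Q : E → ℝ} (hQ : Continuous Q) {v₀ : E} (h0 : Q v₀ ≠ 0)
    (hpoly : ∀ v, ∃ q : Polynomial ℝ, ∀ t : ℝ, Q (v₀ + t • v) = q.eval t) :
    μ {v | Q v = 0} = 0 := by
  have hmeas : MeasurableSet {x : E × ℝ | Q (v₀ + x.2 • x.1) = 0} :=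
    (isClosed_eq (by fun_prop) continuous_const).measurableSet
  have hslice : ∀ v, volume {t : ℝ | Q (v₀ + t • v) = 0} = 0 := by
    intro v
    obtain ⟨q, hq⟩ := hpoly v
    have hq0 : q ≠ 0 := by
      rintro rfl
      exact h0 (by simpa using hq 0)
    simp_rw [hq]
    exact (q.finite_setOfPred_isRoot hq0).measure_zero _
  have hprod : (μ.prod volume) {x : E × ℝ | Q (v₀ + x.2 • x.1) = 0} = 0 :=
    (Measure.measure_prod_null hmeas).2 (ae_of_all _ hslice)
  rw [← Measure.prod_swap, Measure.map_apply measurable_swap hmeas,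
    Measure.measure_prod_null (measurable_swap hmeas)] at hprod
  have hne : ∀ᵐ t : ℝ, t ≠ 0 := by simp [ae_iff, measure_singleton]
  -- Fubini in the other order: some slice at t ≠ 0 is null, and it is the zero set of `Q` up to
  -- translation and scaling.
  obtain ⟨t, ht, ht0⟩ := (hprod.and hne).exists
  change μ ((t • ·) ⁻¹' ((v₀ + ·) ⁻¹' {v | Q v = 0})) = 0 at ht
  rw [Measure.addHaar_preimage_smul μ ht0, mul_eq_zero, measure_preimage_add] at ht
  refine ht.resolve_left ?_
  simp [ht0]

/-- The spherical measure of a set is a multiple of the Haar measure of the cone over it, and by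
homogeneity the cone over zeros consists of zeros. -/
theorem toSphere_zeros_eq_zero {Q : E → ℝ} (hQ : Continuous Q) {k : ℕ}
    (hhom : ∀ (r : ℝ) v, Q (r • v) = r ^ k * Q v) {v₀ : E} (h0 : Q v₀ ≠ 0)
    (hpoly : ∀ v, ∃ q : Polynomial ℝ, ∀ t : ℝ, Q (v₀ + t • v) = q.eval t) :
    μ.toSphere {γ : Metric.sphere (0 : E) 1 | Q γ = 0} = 0 := by
  have hc : IsClosed {γ : Metric.sphere (0 : E) 1 | Q γ = 0} :=
    isClosed_eq (hQ.comp continuous_subtype_val) continuous_const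
  rw [μ.toSphere_apply' hc.measurableSet, mul_eq_zero]
  refine Or.inr (measure_mono_null ?_ (measure_zeros_eq_zero μ hQ h0 hpoly))
  rintro _ ⟨r, _, _, ⟨γ, hγ, rfl⟩, rfl⟩
  simp only [mem_ofPred_eq] at hγ ⊢
  rw [hhom, hγ, mul_zero]

end NullSet

end DimRed

/-! ### The theorem -/

theorem lemma1 {Ω H₁ H₂ : Type*} [MeasurableSpace Ω]
    [NormedAddCommGroup H₁] [InnerProductSpace ℝ H₁] [CompleteSpace H₁]
    [TopologicalSpace.SeparableSpace H₁]
    [NormedAddCommGroup H₂] [InnerProductSpace ℝ H₂] [CompleteSpace H₂]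
    [MeasurableSpace H₂] [BorelSpace H₂]
    (P : Measure Ω) [IsProbabilityMeasure P]
    (ρ : HilbertBasis ℕ ℝ H₂)
    (U : Ω → H₁) (X : Ω → H₂) (hX : Measurable X)
    (hU : Integrable U P) (hU0 : ∫ ω, U ω ∂P = 0) :
    -- (A)
    List.TFAE
      [∀ᵐ ω ∂P, DimRed.condExpGiven P U X ω = 0,
       ∀ p : ℕ, 1 ≤ p → ∀ γ : DimRed.Sph p,
         DimRed.InnerCondExpZero P U (DimRed.proj ρ X γ),
       ∀ p : ℕ, 1 ≤ p → ∀ γ : DimRed.Sph p,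
         DimRed.InnerCondExpZero P U (DimRed.cdfProj P ρ X γ)] ∧
    -- (B)
    ((∀ s : ℝ, 0 < s → Integrable (fun ω => ‖U ω‖ * Real.exp (s * ‖X ω‖)) P) →
      P {ω | DimRed.condExpGiven P U X ω = 0} < 1 →
      ∃ p₀ : ℕ, 1 ≤ p₀ ∧ ∀ p : ℕ, p₀ ≤ p →
        {γ : DimRed.Sph p | ∀ᵐ ω ∂P, DimRed.condExpGiven P U (DimRed.proj ρ X γ) ω = 0} =
          {γ : DimRed.Sph p | ∀ᵐ ω ∂P, DimRed.condExpGiven P U (DimRed.cdfProj P ρ X γ) ω = 0} ∧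
        (volume : Measure (EuclideanSpace ℝ (Fin p))).toSphere
          {γ : DimRed.Sph p |
            ∀ᵐ ω ∂P, DimRed.condExpGiven P U (DimRed.proj ρ X γ) ω = 0} = 0 ∧
        ¬ Dense {γ : DimRed.Sph p |
            ∀ᵐ ω ∂P, DimRed.condExpGiven P U (DimRed.proj ρ X γ) ω = 0}) := by
  have hY : ∀ {p : ℕ} (γ : DimRed.Sph p), Measurable (DimRed.proj ρ X γ) :=
    fun γ => DimRed.measurable_proj ρ hX γ
  have hcdf : ∀ {p : ℕ} (γ : DimRed.Sph p),
      (∀ᵐ ω ∂P, DimRed.condExpGiven P U (DimRed.cdfProj P ρ X γ) ω = 0) ↔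
        ∀ᵐ ω ∂P, DimRed.condExpGiven P U (DimRed.proj ρ X γ) ω = 0 :=
    fun γ => DimRed.condExpGiven_cdf_eq_zero_iff hU (hY γ)
  have hYF : ∀ {p : ℕ} (γ : DimRed.Sph p), Measurable (DimRed.cdfProj P ρ X γ) := fun γ =>
    (show Monotone fun t => P.real {ω | DimRed.proj ρ X γ ω ≤ t} from fun a b hab =>
      measureReal_mono fun ω (hω : _ ≤ a) => hω.trans hab).measurable.comp (hY γ)
  have hall := DimRed.condExpGiven_eq_zero_iff_forall_proj ρ hX hU
  refine ⟨?_, fun hexp hlt => ?_⟩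
  · simp_rw [fun (p : ℕ) (γ : DimRed.Sph p) => DimRed.innerCondExpZero_iff hU (hY γ),
      fun (p : ℕ) (γ : DimRed.Sph p) => DimRed.innerCondExpZero_iff hU (hYF γ), hcdf]
    tfae_have 1 ↔ 2 := hall
    tfae_have 2 ↔ 3 := Iff.rfl
    tfae_finish
  have hne : ¬ ∀ᵐ ω ∂P, DimRed.condExpGiven P U X ω = 0 := fun h =>
    hlt.ne ((measure_eq_measure_of_null_sdiff (subset_univ _)
      (by rw [← compl_eq_univ_sdiff]; exact ae_iff.1 h)).trans measure_univ)
  rw [hall] at hne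
  obtain ⟨p₀, hp₀, γ₀, hγ₀⟩ : ∃ p, 1 ≤ p ∧ ∃ γ : DimRed.Sph p,
      ¬ ∀ᵐ ω ∂P, DimRed.condExpGiven P U (DimRed.proj ρ X γ) ω = 0 := by
    by_contra! hcon
    exact hne fun p hp γ => by_contra fun h => h (by simpa using hcon p hp γ)
  refine ⟨p₀, hp₀, fun p hp => ⟨?_, ?_⟩⟩
  · ext γ
    exact (hcdf γ).symm
  have hUx : ∀ x, Integrable (fun ω => inner ℝ x (U ω)) P := fun x => hU.const_inner x
  have hexp' : ∀ x (Z : Ω → ℝ), AEStronglyMeasurable Z P → (∀ ω, |Z ω| ≤ ‖X ω‖) →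
      ∀ s : ℝ, 0 < s → Integrable (fun ω => |inner ℝ x (U ω)| * Real.exp (s * |Z ω|)) P := by
    intro x Z hZ hZX s hs
    refine Integrable.mono' ((hexp s hs).const_mul ‖x‖) ?_ (ae_of_all _ fun ω => ?_)
    · exact (hUx x).1.norm.mul (Real.continuous_exp.comp_aestronglyMeasurable
        (hZ.norm.const_mul s))
    · rw [Real.norm_of_nonneg (by positivity), ← mul_assoc]
      gcongr
      · exact abs_real_inner_le_norm _ _
      · exact hZX ω
  have hmom : ∀ γ : DimRed.Sph p,
      (∀ᵐ ω ∂P, DimRed.condExpGiven P U (DimRed.proj ρ X γ) ω = 0) ↔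
        ∀ (x : H₁) (k : ℕ),
          ∫ ω, inner ℝ x (U ω) * inner ℝ (X ω) (DimRed.embedLin ρ p γ) ^ k ∂P = 0 := by
    intro γ
    refine (DimRed.condExp_eq_zero_iff_inner (hY γ).comap_le hU).trans (forall_congr' fun x => ?_)
    refine DimRed.condExp_eq_zero_iff_moments (hUx x) (hY γ)
      (hexp' x _ (hY γ).aestronglyMeasurable fun ω => ?_)
    exact (abs_real_inner_le_norm _ _).trans (by rw [DimRed.norm_embed, mul_one])
  have hk : ∀ x k, Integrable (fun ω => inner ℝ x (U ω) * ‖X ω‖ ^ k) P := fun x k =>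
    DimRed.integrable_mul_pow_of_exp (hUx x).1 hX.norm.aestronglyMeasurable
      (hexp' x _ hX.norm.aestronglyMeasurable fun ω => by rw [abs_norm]) k
  have hcont : ∀ x k, Continuous fun v : EuclideanSpace ℝ (Fin p) =>
      ∫ ω, inner ℝ x (U ω) * inner ℝ (X ω) (DimRed.embedLin ρ p v) ^ k ∂P := fun x k =>
    (DimRed.continuous_integral_mul_inner_pow hX (hUx x).1 (hk x k)).comp
      (LinearMap.continuous_of_finiteDimensional _)
  -- Padding with zeros carries the bad direction from dimension p₀ to every p ≥ p₀.
  obtain ⟨γ₁, hγ₁⟩ := DimRed.exists_sph_embed_eq ρ hp γ₀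
  have hγ₁' : ¬ ∀ᵐ ω ∂P, DimRed.condExpGiven P U (DimRed.proj ρ X γ₁) ω = 0 := by
    rwa [show DimRed.proj ρ X γ₁ = DimRed.proj ρ X γ₀ by unfold DimRed.proj; rw [hγ₁]]
  have hclosed : IsClosed {γ : DimRed.Sph p |
      ∀ᵐ ω ∂P, DimRed.condExpGiven P U (DimRed.proj ρ X γ) ω = 0} := by
    simp_rw [hmom, ofPred_forall]
    exact isClosed_iInter fun x => isClosed_iInter fun k =>
      isClosed_eq ((hcont x k).comp continuous_subtype_val) continuous_const
  refine ⟨?_, fun hd => ?_⟩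
  · rw [hmom] at hγ₁'
    push Not at hγ₁'
    obtain ⟨x, k, hxk⟩ := hγ₁'
    refine measure_mono_null (fun γ hγ => (hmom γ).1 hγ x k)
      (DimRed.toSphere_zeros_eq_zero volume (hcont x k) (k := k) (fun r v => ?_) hxk fun v => ?_)
    · rw [← integral_const_mul]
      refine integral_congr_ae (ae_of_all _ fun ω => ?_)
      simp only [map_smul, inner_smul_right, mul_pow]
      ring
    · simp_rw [map_add, map_smul]
      exact DimRed.exists_polynomial_integral_mul_inner_pow hX (hUx x).1 (hk x k) _ _
  · have hmem := hd γ₁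
    rw [hclosed.closure_eq] at hmem
    exact hγ₁' hmem
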